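/- **Conventions.** Let $K$ be a field of characteristic $p>0$ and let $R=\bigoplus_{i\ge 0}R_i$ be a standard graded $K$-algebra, i.e. $R_0=K$, $R=K[R_1]$ and $\dim_K R_1<\infty$; put $\mathfrak m=\bigoplus_{i\ge 1}R_i$. For a ring $A$ with $p=0$ in $A$ and $e\ge 0$, write $A^{1/p^e}$ for the $A$-module $\{x^{1/p^e}: x\in A\}$, a copy of $A$ with action $r\cdot x^{1/p^e}=(r^{p^e}x)^{1/p^e}$. Assume that $R$ is $F$-finite ($R^{1/p}$ is a finitely generated $R$-module) and $F$-pure (the map $M\to R^{1/p}\otimes_R M$ induced by Frobenius is injective for every $R$-module $M$). * An ideal $J\subseteq R$ is *compatible* if $\varphi(J^{1/p^e})\subseteq J$ for all $e\ge 0$ and all $\varphi\in\operatorname{Hom}_R(R^{1/p^e},R)$. * For an ideal $I$ of $A$, $\operatorname{fpt}(I)\in[0,\infty]$ is the supremum of the real numbers $\lambda\ge 0$ such that for all $e\gg 0$ there is $f\in I^{\lfloor (p^e-1)\lambda\rfloor}$ for which the $A$-linear map $A\to A^{1/p^e}$, $1\mapsto f^{1/p^e}$, splits. Write $\operatorname{fpt}(R)=\operatorname{fpt}(\mathfrak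 m)$ and $\operatorname{fpt}(R/J)=\operatorname{fpt}(\mathfrak m(R/J))$. (Thus $\operatorname{fpt}$ of the zero ring is $+\infty$.) * The *test ideal* is $\tau=\bigcap_M\operatorname{ann}_R(0^*_M)$ over all $R$-modules $M$, where $0^*_M$ consists of those $z\in M$ for which some $c\in R$ lying in no minimal prime of $R$ satisfies $c^{1/p^e}\otimes z=0$ in $R^{1/p^e}\otimes_R M$ for all $e\gg 0$. * The *splitting prime* is $\mathcal P=\bigcap_{e\ge 0}\{r\in R:\varphi(r^{1/p^e})\in\mathfrak m\text{ for all }\varphi\in\operatorname{Hom}_R(R^{1/p^e},R)\}$, and $\operatorname{sdim}(R)=\dim(R/\mathcal P)$ is the Krull dimension. **Theorem.** For every compatible ideal $J\subseteq R$, $$\operatorname{fpt}(R)\le\operatorname{fpt}(R/J).$$ In particular, $$\operatorname{fpt}(R)\le\operatorname{fpt}(R/\tau)\qquad\text{and}\qquad \operatorname{fpt}(R)\le\operatorname{fpt}(R/\mathcal P)\le\operatorname{sdim}(R).$$ -/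

import Mathlib

open Filter TensorProduct
open scoped ENNReal NNReal

universe u

noncomputable section

namespace FThreshold

/-- The `e`-th iterate `x ↦ x ^ (p ^ e)` of the Frobenius endomorphism of an `𝔽_p`-algebra
(the zero ring is allowed). -/
def iterFrob (p : ℕ) [Fact p.Prime] (e : ℕ) (R : Type u) [CommRing R] [Algebra (ZMod p) R] :
    R →+* R where
  toFun x := x ^ (p ^ e)
  map_one' := one_pow _
  map_mul' x y := mul_pow x y _
  map_zero' := zero_pow (pow_ne_zero _ (Fact.out (p := p.Prime)).ne_zero)
  map_add' x y := by
    rcases subsingleton_or_nontrivial R with h | h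
    · exact Subsingleton.elim _ _
    · have : CharP R p :=
        charP_of_injective_algebraMap (algebraMap (ZMod p) R).injective p
      exact add_pow_char_pow x y p e

/-- The ring `R^{1/p^e}`: its elements are written `x^{1/p^e}` with `x ∈ R`, so as a ring it is a
copy of `R`; the `R`-algebra structure, given below, is through the `e`-th iterated Frobenius. -/
def Root (_p _e : ℕ) (R : Type u) : Type u := R

instance (p e : ℕ) (R : Type u) [CommRing R] : CommRing (Root p e R) :=
  inferInstanceAs (CommRing R)

/-- The ring isomorphism `R ≃ R^{1/p^e}`, `x ↦ x^{1/p^e}`. -/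
def root (p e : ℕ) {R : Type u} [CommRing R] : R ≃+* Root p e R := RingEquiv.refl R

instance (p : ℕ) [Fact p.Prime] (e : ℕ) (R : Type u) [CommRing R] [Algebra (ZMod p) R] :
    Algebra R (Root p e R) :=
  ((root p e : R ≃+* Root p e R).toRingHom.comp (iterFrob p e R)).toAlgebra

/-- `r · x^{1/p^e} = (r^{p^e} x)^{1/p^e}`. -/
theorem smul_root (p : ℕ) [Fact p.Prime] (e : ℕ) {R : Type u} [CommRing R] [Algebra (ZMod p) R]
    (r x : R) : r • root p e x = root p e (r ^ (p ^ e) * x) := rfl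

section Rings

variable (p : ℕ) [Fact p.Prime] (R : Type u) [CommRing R] [Algebra (ZMod p) R]

/-- `R` is `F`-finite: it is a finite module over itself through the Frobenius endomorphism. -/
def IsFFinite : Prop := Module.Finite R (Root p 1 R)

/-- `R` is `F`-pure: the Frobenius `R → R^{1/p}` stays injective after tensoring with any
`R`-module. -/
def IsFPure : Prop :=
  ∀ (M : Type u) [AddCommGroup M] [Module R M],
    Function.Injective (LinearMap.rTensor M (Algebra.linearMap R (Root p 1 R)))

/-- The tight closure `0^*_M` of zero in the `R`-module `M`: those `z` for which there is `c`
outside every minimal prime of `R` with `c · z^q = 0`, that is `c^{1/q} ⊗ z = 0` in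
`F^e(M) = R^{1/q} ⊗ M`, for all `q = p^e ≫ 0`. -/
def zeroTightClosure (M : Type u) [AddCommGroup M] [Module R M] : Submodule R M where
  carrier := {z | ∃ c : R, (∀ Q ∈ minimalPrimes R, c ∉ Q) ∧
    ∀ᶠ e : ℕ in atTop, (root p e c) ⊗ₜ[R] z = (0 : Root p e R ⊗[R] M)}
  zero_mem' := ⟨1, fun Q hQ h => hQ.1.1.ne_top ((Ideal.eq_top_iff_one Q).2 h),
    Eventually.of_forall fun e => TensorProduct.tmul_zero _ _⟩
  add_mem' := by
    rintro x y ⟨c, hc, hx⟩ ⟨d, hd, hy⟩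
    refine ⟨c * d, fun Q hQ h => ?_, ?_⟩
    · rcases hQ.1.1.mem_or_mem h with h | h
      exacts [hc Q hQ h, hd Q hQ h]
    · filter_upwards [hx, hy] with e hx hy
      have h1 : root p e (c * d) ⊗ₜ[R] x = (0 : Root p e R ⊗[R] M) := by
        have := congrArg (LinearMap.rTensor M (LinearMap.mulLeft R (root p e d))) hx
        simpa [mul_comm] using this
      have h2 : root p e (c * d) ⊗ₜ[R] y = (0 : Root p e R ⊗[R] M) := by
        have := congrArg (LinearMap.rTensor M (LinearMap.mulLeft R (root p e c))) hy
        simpa using this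
      rw [TensorProduct.tmul_add, h1, h2, add_zero]
  smul_mem' := by
    rintro r x ⟨c, hc, hx⟩
    refine ⟨c, hc, ?_⟩
    filter_upwards [hx] with e hx
    rw [TensorProduct.tmul_smul, hx, smul_zero]

/-- The (big) test ideal `τ(R) = ⋂_M ann(0^*_M)`, over all `R`-modules `M`. -/
def testIdeal : Ideal R :=
  ⨅ (M : Type u) (_ : AddCommGroup M) (_ : Module R M), (zeroTightClosure p R M).annihilator

end Rings

section Ideals

variable (p : ℕ) [Fact p.Prime] {R : Type u} [CommRing R] [Algebra (ZMod p) R]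

/-- `J` is compatible: `φ(J^{1/p^e}) ⊆ J` for all `e` and all `R`-linear `φ : R^{1/p^e} → R`. -/
def IsCompatible (J : Ideal R) : Prop :=
  ∀ (e : ℕ) (φ : Root p e R →ₗ[R] R), ∀ x ∈ J, φ (root p e x) ∈ J

/-- The pair `(R, I^t)` is `F`-pure: for all `e ≫ 0` there is `f ∈ I^{⌊(p^e-1)t⌋}` for which the
`R`-linear map `R → R^{1/p^e}`, `1 ↦ f^{1/p^e}`, splits. -/
def IsFPurePair (I : Ideal R) (t : ℝ≥0) : Prop :=
  ∀ᶠ e : ℕ in atTop, ∃ f ∈ I ^ ⌊((p : ℝ) ^ e - 1) * (t : ℝ)⌋₊,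
    ∃ φ : Root p e R →ₗ[R] R,
      φ ∘ₗ LinearMap.toSpanSingleton R (Root p e R) (root p e f) = LinearMap.id

/-- The `F`-pure threshold of the ideal `I` of `R`, as a supremum in `[0, ∞]`. -/
def fpt (I : Ideal R) : ℝ≥0∞ := ⨆ (t : ℝ≥0) (_ : IsFPurePair p I t), (t : ℝ≥0∞)

/-- `I_e(R) = {r ∈ R | φ(r^{1/p^e}) ∈ 𝔪 for all φ ∈ Hom_R(R^{1/p^e}, R)}`. -/
def splittingIdeal (𝔪 : Ideal R) (e : ℕ) : Ideal R where
  carrier := {r | ∀ φ : Root p e R →ₗ[R] R, φ (root p e r) ∈ 𝔪}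
  zero_mem' φ := by simp
  add_mem' {a b} ha hb φ := by
    rw [map_add, map_add]
    exact 𝔪.add_mem (ha φ) (hb φ)
  smul_mem' s r hr φ := by
    have := hr (φ ∘ₗ LinearMap.mulLeft R (root p e s))
    simpa using this

/-- The splitting prime `𝒫(R) = ⋂_e I_e(R)`. -/
def splittingPrime (𝔪 : Ideal R) : Ideal R := ⨅ e : ℕ, splittingIdeal p 𝔪 e

/-- The splitting dimension `sdim(R) = dim(R/𝒫(R))`. -/
def sdim (𝔪 : Ideal R) : WithBot ℕ∞ := ringKrullDim (R ⧸ splittingPrime p 𝔪)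

end Ideals

/-- `R = ⨁ 𝒜 i` is a standard graded `K`-algebra: `R₀ = K`, `R = K[R₁]` and `dim_K R₁ < ∞`. -/
structure IsStandardGraded {K : Type*} {R : Type u} [Field K] [CommRing R] [Algebra K R]
    (𝒜 : ℕ → Submodule K R) [GradedAlgebra 𝒜] : Prop where
  injective : Function.Injective (algebraMap K R)
  degree_zero : ∀ x ∈ 𝒜 0, ∃ a : K, algebraMap K R a = x
  generated : Algebra.adjoin K (𝒜 1 : Set R) = ⊤
  finite : Module.Finite K (𝒜 1)

end FThreshold

end

open FThreshold

/-! Write q = p^e. A splitting φ with φ(f^{1/q}) = 1 descends to R/J when J is compatible, and it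
then splits the image of f. Every exponent admissible for 𝔪 is therefore admissible for 𝔪(R/J), so
fpt(R) ≤ fpt(R/J). It remains to see that τ and 𝒫 are compatible. For τ, z ↦ 1 ⊗ z carries 0^*_M
into 0^* of F^e(M). For 𝒫, composing maps R^{1/q'} → R and R^{1/q} → R gives a map R^{1/qq'} → R.

For fpt(R/𝒫) ≤ dim(R/𝒫), let S = R/𝒫, which is graded because 𝒫 is homogeneous, and let V be its
space of linear forms. An f that splits at level e lies outside the Frobenius power (v^q : v ∈ V).
Over an infinite field, linear Noether normalization gives n ≤ dim S algebraically independent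
linear forms y_i with V^{c+1} ⊆ V^c·⟨y⟩. By pigeonhole (y)^{nq+1} ⊆ (y_i^q), hence (V)^{c+nq+1} ⊆
(v^q : v ∈ V); a finite field is first replaced by its algebraic closure. So an admissible t
satisfies (q-1)t < nq + c + 1 for all large e, which forces t ≤ n. -/

namespace FThreshold

/-! ### Descent of splittings along compatible ideals; the splitting prime -/

section Compatible

variable (p : ℕ) [Fact p.Prime] {R : Type u} [CommRing R] [Algebra (ZMod p) R]

theorem root_mul_smul {e : ℕ} {M : Type*} [AddCommGroup M] [Module R M]
    (φ : Root p e R →ₗ[R] M) (s x : R) :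
    φ (root p e (s ^ p ^ e * x)) = s • φ (root p e x) := by
  rw [← smul_root, map_smul]

variable {p} in
/-- An additive map `f : R → R` with `f (s ^ (p ^ e) x) = s f x` is an `R`-linear map
`R^{1/p^e} → R`. -/
def linearMapOfRoot (e : ℕ) (f : R →+ R) (hf : ∀ s x, f (s ^ p ^ e * x) = s * f x) :
    Root p e R →ₗ[R] R where
  toFun x := f ((root p e).symm x)
  map_add' x y := by simp
  map_smul' s x := by
    obtain ⟨x, rfl⟩ := (root p e).surjective x
    rw [smul_root]
    simpa using hf s x

@[simp]
theorem linearMapOfRoot_root (e : ℕ) (f : R →+ R) (hf : ∀ s x, f (s ^ p ^ e * x) = s * f x)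
    (x : R) : linearMapOfRoot e f hf (root p e x) = f x := by
  simp [linearMapOfRoot]

/-- The underlying additive map `x ↦ φ (x^{1/p^e})`. -/
def rootHom {e : ℕ} (φ : Root p e R →ₗ[R] R) : R →+ R :=
  φ.toAddMonoidHom.comp (root p e : R ≃+* Root p e R).toRingHom.toAddMonoidHom

@[simp]
theorem rootHom_apply {e : ℕ} (φ : Root p e R →ₗ[R] R) (x : R) :
    rootHom p φ x = φ (root p e x) := rfl

/-- Compatibility says precisely that x ↦ φ(x^{1/q}) mod J kills J. -/
theorem exists_linearMap_quotient {J : Ideal R} (hJ : IsCompatible p J) {e : ℕ}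
    (φ : Root p e R →ₗ[R] R) :
    ∃ ψ : Root p e (R ⧸ J) →ₗ[R ⧸ J] (R ⧸ J), ∀ x : R,
      ψ (root p e (Ideal.Quotient.mk J x)) = Ideal.Quotient.mk J (φ (root p e x)) := by
  have hs : Function.Surjective (Ideal.Quotient.mk J).toAddMonoidHom :=
    Ideal.Quotient.mk_surjective
  let g : R →+ R ⧸ J := (Ideal.Quotient.mk J).toAddMonoidHom.comp (rootHom p φ)
  have hg : (Ideal.Quotient.mk J).toAddMonoidHom.ker ≤ g.ker := by
    intro x hx
    have hx' : x ∈ J := Ideal.Quotient.eq_zero_iff_mem.1 hx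
    exact Ideal.Quotient.eq_zero_iff_mem.2 (hJ e φ x hx')
  let f : R ⧸ J →+ R ⧸ J := AddMonoidHom.liftOfSurjective _ hs ⟨g, hg⟩
  have hf : ∀ x : R, f (Ideal.Quotient.mk J x) = Ideal.Quotient.mk J (φ (root p e x)) :=
    fun x => AddMonoidHom.liftOfRightInverse_comp_apply _ _ (Function.rightInverse_surjInv hs)
      ⟨g, hg⟩ x
  refine ⟨linearMapOfRoot e f ?_, fun x => by rw [linearMapOfRoot_root, hf]⟩
  intro s x
  obtain ⟨s, rfl⟩ := Ideal.Quotient.mk_surjective s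
  obtain ⟨x, rfl⟩ := Ideal.Quotient.mk_surjective x
  rw [← map_pow, ← map_mul, hf, hf, root_mul_smul, smul_eq_mul, map_mul]

theorem toSpanSingleton_comp_eq_id_iff {e : ℕ} (f : R) (φ : Root p e R →ₗ[R] R) :
    φ ∘ₗ LinearMap.toSpanSingleton R (Root p e R) (root p e f) = LinearMap.id ↔
      φ (root p e f) = 1 := by
  constructor
  · intro h
    simpa using LinearMap.congr_fun h 1
  · intro h
    ext
    simpa using h

theorem IsFPurePair.map_quotient {I J : Ideal R} (hJ : IsCompatible p J) {t : ℝ≥0}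
    (h : IsFPurePair p I t) : IsFPurePair p (I.map (Ideal.Quotient.mk J)) t := by
  filter_upwards [h] with e he
  obtain ⟨f, hf, φ, hφ⟩ := he
  obtain ⟨ψ, hψ⟩ := exists_linearMap_quotient p hJ φ
  refine ⟨Ideal.Quotient.mk J f, ?_, ψ, ?_⟩
  · rw [← Ideal.map_pow]
    exact Ideal.mem_map_of_mem _ hf
  · rw [toSpanSingleton_comp_eq_id_iff] at hφ ⊢
    rw [hψ, hφ, map_one]

theorem fpt_le_fpt_map_quotient (I : Ideal R) {J : Ideal R} (hJ : IsCompatible p J) :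
    fpt p I ≤ fpt p (I.map (Ideal.Quotient.mk J)) :=
  iSup₂_le fun t ht => le_iSup₂_of_le t (ht.map_quotient p hJ) le_rfl

/-- For ψ at level e' and φ at level e, the composite x ↦ ψ((φ(x^{1/p^e}))^{1/p^e'}) is a test map
at level e' + e, so it sends 𝒫 into 𝔪. -/
theorem isCompatible_splittingPrime (𝔪 : Ideal R) : IsCompatible p (splittingPrime p 𝔪) := by
  intro e φ x hx
  simp only [splittingPrime, Ideal.mem_iInf] at hx ⊢
  intro e' ψ
  have hlin : ∀ s x, ((rootHom p ψ).comp (rootHom p φ)) (s ^ p ^ (e' + e) * x) =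
      s * ((rootHom p ψ).comp (rootHom p φ)) x := by
    intro s x
    simp only [AddMonoidHom.comp_apply, rootHom_apply]
    rw [pow_add, pow_mul, root_mul_smul, smul_eq_mul, root_mul_smul, smul_eq_mul]
  simpa using hx (e' + e) (linearMapOfRoot (e' + e) _ hlin)

theorem splittingPrime_le (𝔪 : Ideal R) : splittingPrime p 𝔪 ≤ 𝔪 := by
  intro x hx
  have h0 := (Ideal.mem_iInf.1 hx) 0 (linearMapOfRoot 0 (AddMonoidHom.id R) (by simp))
  simpa using h0

end Compatible

/-! ### Compatibility of the test ideal -/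

section TestIdeal

variable (p : ℕ) [Fact p.Prime] (e : ℕ) (R : Type u) [CommRing R] [Algebra (ZMod p) R]
  (M : Type u) [AddCommGroup M] [Module R M]

/-- The Peskine–Szpiro functor `F^e(M) = R^{1/p^e} ⊗ M`, as an `R`-module through the isomorphism
`R ≃ R^{1/p^e}`. -/
def FrobeniusPullback : Type u := Root p e R ⊗[R] M

instance : AddCommGroup (FrobeniusPullback p e R M) :=
  inferInstanceAs (AddCommGroup (Root p e R ⊗[R] M))

instance : Module (Root p e R) (FrobeniusPullback p e R M) :=
  inferInstanceAs (Module (Root p e R) (Root p e R ⊗[R] M))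

instance : Module R (FrobeniusPullback p e R M) :=
  Module.compHom _ (root p e : R ≃+* Root p e R).toRingHom

variable {R M}

/-- The element `x^{1/p^e} ⊗ z` of `F^e(M)`. -/
def frobTmul (x : R) (z : M) : FrobeniusPullback p e R M := root p e x ⊗ₜ[R] z

theorem smul_frobTmul (s x : R) (z : M) :
    s • frobTmul p e x z = frobTmul p e (s * x) z := rfl

theorem frobTmul_smul (s x : R) (z : M) :
    frobTmul p e x (s • z) = frobTmul p e (s ^ p ^ e * x) z := by
  unfold frobTmul
  rw [← smul_root, TensorProduct.smul_tmul]

theorem frobTmul_add (x : R) (z w : M) :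
    frobTmul p e x (z + w) = frobTmul p e x z + frobTmul p e x w :=
  TensorProduct.tmul_add _ _ _

/-- The comparison map `F^{e'+e}(M) → F^{e'}(F^e(M))`. -/
def frobeniusPullbackComp (e' : ℕ) :
    Root p (e' + e) R ⊗[R] M →+ Root p e' R ⊗[R] FrobeniusPullback p e R M :=
  TensorProduct.liftAddHom
    (AddMonoidHom.mk' (fun a => AddMonoidHom.mk'
      (fun z => root p e' ((root p (e' + e)).symm a) ⊗ₜ[R] frobTmul p e 1 z)
      (fun z w => by rw [frobTmul_add, TensorProduct.tmul_add]))
      (fun a b => by ext z; simp [TensorProduct.add_tmul]))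
    (fun s a z => by
      obtain ⟨a, rfl⟩ := (root p (e' + e)).surjective a
      rw [smul_root]
      simp only [AddMonoidHom.mk'_apply, RingEquiv.symm_apply_apply]
      rw [frobTmul_smul, ← smul_frobTmul, ← TensorProduct.smul_tmul, smul_root, pow_add, pow_mul,
        ← pow_mul, ← pow_mul, mul_comm (p ^ e)])

/-- The same c works: the comparison map sends c^{1/p^(e'+e)} ⊗ z to c^{1/p^e'} ⊗ (1 ⊗ z). -/
theorem frobTmul_one_mem_zeroTightClosure {z : M} (hz : z ∈ zeroTightClosure p R M) :
    frobTmul p e 1 z ∈ zeroTightClosure p R (FrobeniusPullback p e R M) := by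
  obtain ⟨c, hc, h⟩ := hz
  refine ⟨c, hc, ?_⟩
  filter_upwards [(tendsto_add_atTop_nat e).eventually h] with e' he'
  have := congrArg (frobeniusPullbackComp p e (M := M) e') he'
  simpa [frobeniusPullbackComp] using this

variable (R) in
-- If x kills 0^* of F^e(M), then x^{1/q} ⊗ z = 0 for every z in 0^*_M; applying φ ⊗ M gives
-- φ(x^{1/q}) z = 0.
theorem isCompatible_testIdeal : IsCompatible p (testIdeal p R) := by
  intro e φ x hx
  simp only [testIdeal, Ideal.mem_iInf] at hx ⊢
  intro M _ _
  rw [Submodule.mem_annihilator]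
  intro z hz
  have h0 := (Submodule.mem_annihilator.1 (hx (FrobeniusPullback p e R M) inferInstance
    inferInstance)) _ (frobTmul_one_mem_zeroTightClosure p e hz)
  rw [smul_frobTmul, mul_one] at h0
  have h1 : root p e x ⊗ₜ[R] z = (0 : Root p e R ⊗[R] M) := h0
  simpa using congrArg (TensorProduct.lid R M ∘ LinearMap.rTensor M φ) h1

end TestIdeal

/-! ### Homogeneity of the splitting prime -/

section Homogeneous

variable (p : ℕ) [Fact p.Prime] {K : Type*} {R : Type u} [Field K] [CommRing R]
  [Algebra (ZMod p) R] [Algebra K R] (𝒜 : ℕ → Submodule K R) [GradedAlgebra 𝒜]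

open DirectSum

/-- The part of `x ↦ φ (x^{1/p^e})` that sends degree `i + p ^ e * n` to degree `n`. -/
def gradedPart {e : ℕ} (φ : Root p e R →ₗ[R] R) (i : ℕ) : R →+ R :=
  (DirectSum.toAddMonoid fun j =>
    if i ≤ j ∧ p ^ e ∣ j - i then
      ((GradedRing.proj 𝒜 ((j - i) / p ^ e)).comp (rootHom p φ)).comp
        (𝒜 j).subtype.toAddMonoidHom
    else 0).comp (decomposeAddEquiv 𝒜).toAddMonoidHom

theorem gradedPart_of_mem {e : ℕ} (φ : Root p e R →ₗ[R] R) (i : ℕ) {j : ℕ} {x : R}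
    (hx : x ∈ 𝒜 j) : gradedPart p 𝒜 φ i x = if i ≤ j ∧ p ^ e ∣ j - i then
      (decompose 𝒜 (φ (root p e x)) ((j - i) / p ^ e) : R) else 0 := by
  have : decomposeAddEquiv 𝒜 x = DirectSum.of (fun i => 𝒜 i) j ⟨x, hx⟩ :=
    decompose_of_mem 𝒜 hx
  simp only [gradedPart, AddMonoidHom.comp_apply]
  erw [this, DirectSum.toAddMonoid_of]
  split_ifs <;> rfl

/-- For s of degree k, multiplication by s^q raises the source degree by qk and the target degree by
k, preserving the relation between i + qn and n. -/
theorem gradedPart_pow_mul {e : ℕ} (φ : Root p e R →ₗ[R] R) (i : ℕ) (s x : R) :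
    gradedPart p 𝒜 φ i (s ^ p ^ e * x) = s * gradedPart p 𝒜 φ i x := by
  have hq : 0 < p ^ e := pow_pos (Fact.out (p := p.Prime)).pos e
  induction s using DirectSum.Decomposition.inductionOn 𝒜 with
  | zero => simp [zero_pow hq.ne']
  | add s t hs ht =>
    have := (iterFrob p e R).map_add s t
    change (s + t) ^ p ^ e = s ^ p ^ e + t ^ p ^ e at this
    rw [this, add_mul, map_add, hs, ht, add_mul]
  | @homogeneous k s =>
    induction x using DirectSum.Decomposition.inductionOn 𝒜 with
    | zero => simp
    | add x y hx hy => rw [mul_add, map_add, hx, hy, map_add, mul_add]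
    | @homogeneous j x =>
      have hmem : (s : R) ^ p ^ e * x ∈ 𝒜 (p ^ e * k + j) := by
        have := SetLike.pow_mem_graded (A := 𝒜) (p ^ e) s.2
        exact SetLike.mul_mem_graded (by simpa using this) x.2
      rw [gradedPart_of_mem p 𝒜 φ i hmem, gradedPart_of_mem p 𝒜 φ i x.2, root_mul_smul,
        smul_eq_mul]
      by_cases hij : i ≤ j
      · have h1 : p ^ e * k + j - i = p ^ e * k + (j - i) := by omega
        have h2 : i ≤ p ^ e * k + j := by omega
        simp only [h1, h2, hij, true_and, Nat.dvd_add_right (dvd_mul_right _ _)]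
        split_ifs with hd
        · rw [h1, Nat.mul_add_div hq, coe_decompose_mul_add_of_left_mem 𝒜 s.2]
        · rw [mul_zero]
      -- Here j < i, so the target degree (qk + j - i)/q is below k, where a multiple of s has no
      -- component.
      · simp only [hij, false_and, if_false, mul_zero, ite_eq_right_iff]
        rintro ⟨h1, h2⟩
        apply coe_decompose_mul_of_left_mem_of_not_le 𝒜 s.2
        rw [not_le, Nat.div_lt_iff_lt_mul hq, mul_comm k]
        omega

theorem mem_irrelevant_iff_decompose {x : R} :
    x ∈ (HomogeneousIdeal.irrelevant 𝒜).toIdeal ↔ (decompose 𝒜 x 0 : R) = 0 := Iff.rfl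

/-- Only degree i is sent to degree 0 by the graded part of φ, so testing r against that part tests
the component r_i against φ. -/
theorem isHomogeneous_splittingIdeal (e : ℕ) :
    (splittingIdeal p (HomogeneousIdeal.irrelevant 𝒜).toIdeal e).IsHomogeneous 𝒜 := by
  intro i r hr φ
  have hq : 0 < p ^ e := pow_pos (Fact.out (p := p.Prime)).pos e
  have h := hr (linearMapOfRoot e (gradedPart p 𝒜 φ i) (gradedPart_pow_mul p 𝒜 φ i))
  rw [linearMapOfRoot_root, mem_irrelevant_iff_decompose] at h
  rw [mem_irrelevant_iff_decompose]
  classical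
  have hsum := DirectSum.sum_support_decompose 𝒜 r
  have key : ∀ j, (decompose 𝒜 (gradedPart p 𝒜 φ i (decompose 𝒜 r j)) 0 : R) =
      if j = i then (decompose 𝒜 (φ (root p e (decompose 𝒜 r i : R))) 0 : R) else 0 := by
    intro j
    rw [gradedPart_of_mem p 𝒜 φ i (decompose 𝒜 r j).2]
    by_cases hji : j = i
    · subst hji
      rw [if_pos ⟨le_rfl, by simp⟩, if_pos rfl]
      rw [show (j - j) / p ^ e = 0 by simp, decompose_of_mem_same 𝒜 (SetLike.coe_mem _)]
    · rw [if_neg hji]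
      split_ifs with hd
      · rw [decompose_of_mem_ne 𝒜 (SetLike.coe_mem _)]
        intro h0
        obtain ⟨c, hc⟩ := hd.2
        rw [hc, Nat.mul_div_cancel_left _ hq] at h0
        subst h0
        omega
      · simp
  let g : R →+ R := (GradedRing.proj 𝒜 0).comp (gradedPart p 𝒜 φ i)
  have hg : ∀ j, g (decompose 𝒜 r j : R) =
      if j = i then (decompose 𝒜 (φ (root p e (decompose 𝒜 r i : R))) 0 : R) else 0 := key
  have h' : g r = 0 := h
  rw [← hsum, map_sum, Finset.sum_congr rfl (fun j _ => hg j), Finset.sum_ite_eq'] at h'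
  split_ifs at h' with hi
  · exact h'
  · have : decompose 𝒜 r i = 0 := by simpa using hi
    rw [this]
    simp

theorem isHomogeneous_splittingPrime :
    (splittingPrime p (HomogeneousIdeal.irrelevant 𝒜).toIdeal).IsHomogeneous 𝒜 :=
  Ideal.IsHomogeneous.iInf fun e => isHomogeneous_splittingIdeal p 𝒜 e

end Homogeneous

end FThreshold

/-! ### Krull dimension of integral extensions -/

section IntegralKrullDim

variable (A B : Type*) [CommRing A] [CommRing B] [Algebra A B] [Algebra.IsIntegral A B]

theorem ringKrullDim_le_of_isIntegral : ringKrullDim B ≤ ringKrullDim A :=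
  Order.krullDim_le_of_strictMono (PrimeSpectrum.comap (algebraMap A B))
    fun _ _ h => Ideal.IsIntegral.comap_lt_comap h

theorem ringKrullDim_le_of_isIntegral_of_injective
    (h : Function.Injective (algebraMap A B)) : ringKrullDim A ≤ ringKrullDim B := by
  refine iSup_le fun l => ?_
  obtain ⟨Q, -, hQ, hQl⟩ := Ideal.exists_ideal_over_prime_of_isIntegral l.head.asIdeal
    (⊥ : Ideal B) (by
      rw [← RingHom.ker_eq_comap_bot, (RingHom.injective_iff_ker_eq_bot _).1 h]
      exact bot_le)
  have : Q.LiesOver l.head.asIdeal := ⟨hQl.symm⟩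
  obtain ⟨l', hl', -⟩ := Ideal.exists_ltSeries_of_hasGoingUp l Q
  rw [← hl']
  exact Order.LTSeries.length_le_krullDim l'

end IntegralKrullDim

/-! ### Powers of spans -/

section SpanPow

/-- Pigeonhole: a product of nq + 1 factors among n generators repeats one of them more than q
times. -/
theorem Ideal.span_range_pow_le {A : Type*} [CommRing A] {n : ℕ} (y : Fin n → A) (q : ℕ) :
    Ideal.span (Set.range y) ^ (n * q + 1) ≤ Ideal.span (Set.range fun i => y i ^ q) := by
  rw [Ideal.span, Submodule.span_pow, Submodule.span_le]
  intro a ha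
  obtain ⟨f, rfl⟩ := Set.mem_pow.1 ha
  choose g hg using fun i => (f i).2
  rw [List.prod_ofFn]
  obtain ⟨j, -, hj⟩ := Finset.exists_lt_card_fiber_of_mul_lt_card_of_maps_to
    (s := Finset.univ) (t := Finset.univ) (f := g) (n := q) (fun _ _ => Finset.mem_univ _)
    (by simp)
  rw [← Finset.prod_fiberwise (s := Finset.univ) (g := g)]
  refine Ideal.mem_of_dvd _ (Finset.dvd_prod_of_mem _ (Finset.mem_univ j)) ?_
  have : ∏ i with g i = j, (f i : A) = y j ^ (Finset.card {i | g i = j}) := by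
    rw [← Finset.prod_const]
    refine Finset.prod_congr rfl fun i hi => ?_
    rw [← hg i, (Finset.mem_filter.1 hi).2]
  rw [this]
  exact Ideal.mem_of_dvd _ (pow_dvd_pow _ hj.le) (Ideal.subset_span ⟨j, rfl⟩)

/-- A product of n + 1 factors either has a factor from M or lies entirely in N. -/
theorem Submodule.sup_pow_succ_le {k A : Type*} [CommSemiring k] [CommSemiring A] [Algebra k A]
    (M N : Submodule k A) (n : ℕ) :
    (M ⊔ N) ^ (n + 1) ≤ M * (M ⊔ N) ^ n ⊔ N ^ (n + 1) := by
  induction n with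
  | zero => simp
  | succ n ih =>
    rw [pow_succ' _ (n + 1), Submodule.sup_mul]
    refine sup_le le_sup_left ((mul_le_mul' le_rfl ih).trans ?_)
    rw [Submodule.mul_sup]
    refine sup_le_sup ?_ (pow_succ' N (n + 1)).ge
    rw [mul_left_comm, pow_succ' _ n]
    exact mul_le_mul' le_rfl (mul_le_mul' le_sup_right le_rfl)

theorem Submodule.FG.span_tower {k A M : Type*} [CommSemiring k] [Semiring A] [Algebra k A]
    [AddCommMonoid M] [Module k M] [Module A M] [IsScalarTower k A M] {N : Submodule k M}
    (h : N.FG) : (Submodule.span A (N : Set M)).FG := by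
  obtain ⟨s, rfl⟩ := h
  exact ⟨s, (Submodule.span_span_of_tower k A (s : Set M)).symm⟩

end SpanPow

/-! ### Linear Noether normalization -/

section LinearNoetherNormalization

open MvPolynomial

variable {k A : Type*} [Field k] [CommRing A] [Algebra k A]

theorem MvPolynomial.IsHomogeneous.aeval_mul_left {σ : Type*} {F : MvPolynomial σ k} {n : ℕ}
    (hF : F.IsHomogeneous n) (z : A) (u : σ → A) :
    MvPolynomial.aeval (fun j => z * u j) F = z ^ n * MvPolynomial.aeval u F := by
  rw [MvPolynomial.aeval_def, MvPolynomial.aeval_def, eval₂_eq, eval₂_eq, Finset.mul_sum]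
  refine Finset.sum_congr rfl fun d hd => ?_
  have hd' := hF.degree_eq_sum_deg_support hd
  rw [hd']
  simp only [mul_pow, Finset.prod_mul_distrib, Finset.prod_pow_eq_pow_sum]
  ring

/-- An algebra map `δ : A → A[X]` that multiplies the elements of `V` by `X`: this encodes a
grading of the algebra generated by `V` with `V` in degree one. -/
def IsDegreeOneCoaction (δ : A →ₐ[k] Polynomial A) (V : Submodule k A) : Prop :=
  ∀ v ∈ V, δ v = Polynomial.monomial 1 v

/-- The coaction places the value of the degree-m component in the coefficient of X^m, so a relation
can be read off coefficient by coefficient. -/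
theorem IsDegreeOneCoaction.aeval_homogeneousComponent_eq_zero {δ : A →ₐ[k] Polynomial A}
    {V : Submodule k A} (hδ : IsDegreeOneCoaction δ V) {σ : Type*} {y : σ → A}
    (hy : ∀ i, y i ∈ V) {F : MvPolynomial σ k} (hF : aeval y F = 0) (n : ℕ) :
    aeval y (homogeneousComponent n F) = 0 := by
  have hG : ∀ m, δ (aeval y (homogeneousComponent m F)) =
      Polynomial.monomial m (aeval y (homogeneousComponent m F)) := by
    intro m
    rw [← AlgHom.comp_apply, comp_aeval]
    have : (fun i => δ (y i)) = fun i => Polynomial.X * Polynomial.CAlgHom (R := k) (y i) := by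
      funext i
      rw [hδ _ (hy i), ← Polynomial.C_mul_X_eq_monomial, mul_comm]
      rfl
    rw [this, (homogeneousComponent_isHomogeneous m F).aeval_mul_left,
      show (fun i => Polynomial.CAlgHom (R := k) (y i)) = (Polynomial.CAlgHom (R := k)) ∘ y from rfl,
      ← Polynomial.C_mul_X_pow_eq_monomial, mul_comm]
    congr 1
    exact (MvPolynomial.comp_aeval_apply _ _ _).symm
  have h0 : δ (aeval y F) = 0 := by rw [hF, map_zero]
  rw [← sum_homogeneousComponent F, map_sum, map_sum, Finset.sum_congr rfl fun m _ => hG m] at h0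
  have := congrArg (fun P => Polynomial.coeff P n) h0
  simp only [Polynomial.finsetSum_coeff, Polynomial.coeff_monomial, Polynomial.coeff_zero,
    Finset.sum_ite_eq'] at this
  split_ifs at this with hn
  · exact this
  · rw [homogeneousComponent_eq_zero, map_zero]
    simpa using hn

/-- Telescoping a product replaces one factor u by u - v at a time. The extra factor w keeps the
exponent n valid also when n = 0. -/
theorem mul_aeval_sub_aeval_mem {W W' : Submodule k A} {σ : Type*} {u v : σ → A}
    (hu : ∀ i, u i ∈ W) (hv : ∀ i, v i ∈ W) (huv : ∀ i, u i - v i ∈ W')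
    {F : MvPolynomial σ k} {n : ℕ} (hF : F.IsHomogeneous n) {w : A} (hw : w ∈ W) :
    w * (aeval u F - aeval v F) ∈ W' * W ^ n := by
  have hlin : ∀ (M : Submodule k A) (f : MvPolynomial σ k →ₗ[k] A), (∀ i, f (X i) ∈ M) →
      ∀ m ∈ homogeneousSubmodule σ k 1, f m ∈ M := by
    intro M f hf m hm
    rw [homogeneousSubmodule_one_eq_span_X] at hm
    have : Submodule.span k (Set.range X) ≤ M.comap f := by
      rw [Submodule.span_le]
      rintro _ ⟨i, rfl⟩
      exact hf i
    exact this hm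
  rw [← mem_homogeneousSubmodule, ← homogeneousSubmodule_one_pow] at hF
  suffices h : aeval u F ∈ W ^ n ∧ ∀ w ∈ W, w * (aeval u F - aeval v F) ∈ W' * W ^ n from
    h.2 w hw
  clear hw w
  induction hF using Submodule.pow_induction_on_left' with
  | algebraMap r => simp
  | add x y i hx hy ihx ihy =>
    refine ⟨by rw [map_add]; exact add_mem ihx.1 ihy.1, fun w hw => ?_⟩
    have := add_mem (ihx.2 w hw) (ihy.2 w hw)
    rw [map_add, map_add]
    convert this using 1
    ring
  | mem_mul m hm i x hx ih =>
    have h1 : aeval u m ∈ W := hlin W (aeval u).toLinearMap (by simpa using hu) m hm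
    have h2 : aeval v m ∈ W := hlin W (aeval v).toLinearMap (by simpa using hv) m hm
    have h3 : aeval u m - aeval v m ∈ W' :=
      hlin W' ((aeval u).toLinearMap - (aeval v).toLinearMap) (by simpa using huv) m hm
    refine ⟨by rw [map_mul, pow_succ']; exact Submodule.mul_mem_mul h1 ih.1, fun w hw => ?_⟩
    have h4 := Submodule.mul_mem_mul h3 (Submodule.mul_mem_mul hw ih.1)
    have h5 := Submodule.mul_mem_mul hw (ih.2 _ h2)
    rw [mul_left_comm] at h5
    rw [← pow_succ'] at h4 h5
    rw [map_mul, map_mul]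
    convert add_mem h4 h5 using 1
    ring

theorem Submodule.pow_add_le_of_pow_succ_le {V W : Submodule k A} {c : ℕ}
    (h : V ^ (c + 1) ≤ V ^ c * W) (m : ℕ) : V ^ (c + m) ≤ V ^ c * W ^ m := by
  induction m with
  | zero => simp
  | succ m ih =>
    calc V ^ (c + (m + 1)) = V ^ (c + m) * V := by rw [← add_assoc, pow_succ]
      _ ≤ V ^ c * W ^ m * V := mul_le_mul' ih le_rfl
      _ = V ^ (c + 1) * W ^ m := by rw [pow_succ, mul_right_comm]
      _ ≤ V ^ c * W * W ^ m := mul_le_mul' h le_rfl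
      _ = V ^ c * W ^ (m + 1) := by rw [pow_succ', mul_assoc]

/-- A dependence yields a nonzero form G of degree m with G(y) = 0. Choose a with G(a) ≠ 0 and a_i ≠
0, and put z = y_i / a_i. Modulo W' = ⟨y_j - a_j z⟩ each y_j becomes a_j z, so G(a) z^m is congruent
to 0 and z^{m+1} ∈ W' W^m. -/
theorem Submodule.exists_finrank_lt_of_not_algebraicIndependent [Infinite k] [Nontrivial A]
    {δ : A →ₐ[k] Polynomial A} {W : Submodule k A} (hδ : IsDegreeOneCoaction δ W) {n : ℕ}
    {y : Fin n → A} (hyW : Submodule.span k (Set.range y) = W)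
    (hy : ¬ AlgebraicIndependent k y) :
    ∃ W' ≤ W, Module.finrank k W' < n ∧ ∃ m, W ^ (m + 1) ≤ W' * W ^ m := by
  classical
  have hyW' : ∀ i, y i ∈ W := fun i => hyW ▸ Submodule.subset_span ⟨i, rfl⟩
  rw [algebraicIndependent_iff] at hy
  push Not at hy
  obtain ⟨F, hF, hF0⟩ := hy
  obtain ⟨m, hm⟩ : ∃ m, homogeneousComponent m F ≠ 0 := by
    by_contra! h
    apply hF0
    rw [← sum_homogeneousComponent F]
    exact Finset.sum_eq_zero fun i _ => h i
  have hGh := homogeneousComponent_isHomogeneous m F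
  have hG := hδ.aeval_homogeneousComponent_eq_zero hyW' hF m
  set G := homogeneousComponent m F
  obtain ⟨i⟩ : Nonempty (Fin n) := by
    by_contra hn
    rw [not_nonempty_iff] at hn
    obtain ⟨a, rfl⟩ := C_surjective (Fin n) F
    rw [aeval_C, map_eq_zero] at hF
    exact hF0 (by rw [hF, map_zero])
  -- The factor X i forces a_i ≠ 0; then y_i - a_i z = 0, and n - 1 elements span W'.
  obtain ⟨a, ha⟩ : ∃ a, eval a (G * X i) ≠ 0 := by
    by_contra! h
    refine mul_ne_zero hm (X_ne_zero i) (MvPolynomial.funext fun a => ?_)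
    rw [h a, map_zero]
  rw [map_mul, eval_X] at ha
  have hGa := left_ne_zero_of_mul ha
  have hai := right_ne_zero_of_mul ha
  let z : A := (a i)⁻¹ • y i
  have hz : z ∈ W := W.smul_mem _ (hyW' i)
  let v : Fin n → A := fun j => z * algebraMap k A (a j)
  have hv : ∀ j, v j = a j • z := fun j => by rw [Algebra.smul_def, mul_comm]
  have hvi : v i = y i := by rw [hv, smul_inv_smul₀ hai]
  have hvW : ∀ j, v j ∈ W := fun j => hv j ▸ W.smul_mem _ hz
  let s : Finset A := (Finset.univ.erase i).image fun j => y j - v j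
  let W' := Submodule.span k (s : Set A)
  have hmem : ∀ j, y j - v j ∈ W' := by
    intro j
    by_cases hj : j = i
    · rw [hj, hvi, sub_self]
      exact zero_mem _
    · exact Submodule.subset_span (Finset.mem_coe.2 (Finset.mem_image_of_mem _ (by simpa using hj)))
  have hle : W' ≤ W := by
    rw [Submodule.span_le]
    intro x hx
    obtain ⟨j, -, rfl⟩ := Finset.mem_image.1 (Finset.mem_coe.1 hx)
    exact sub_mem (hyW' j) (hvW j)
  refine ⟨W', hle, ?_, m, ?_⟩
  · have h1 : s.card ≤ n - 1 := Finset.card_image_le.trans (by simp)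
    have h2 := finrank_span_finset_le_card (R := k) s
    have h3 := i.pos
    exact (h2.trans h1).trans_lt (by omega)
  · have hW : W = W' ⊔ Submodule.span k {z} := by
      refine le_antisymm ?_ (sup_le hle (by simpa using hz))
      rw [← hyW, Submodule.span_le]
      rintro _ ⟨j, rfl⟩
      rw [← sub_add_cancel (y j) (v j)]
      refine Submodule.add_mem_sup (hmem j) ?_
      rw [hv]
      exact Submodule.smul_mem _ _ (Submodule.mem_span_singleton_self z)
    have hpow : z ^ (m + 1) ∈ W' * W ^ m := by
      have h := mul_aeval_sub_aeval_mem hyW' hvW hmem hGh hz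
      have hvG : aeval v G = eval a G • z ^ m := by
        rw [hGh.aeval_mul_left, Algebra.smul_def, mul_comm]
        congr 1
        rw [aeval_def, eval₂_eq, eval_eq, map_sum]
        simp
      rw [hG, hvG, zero_sub, mul_neg, neg_mem_iff, mul_smul_comm, ← pow_succ'] at h
      exact (Submodule.smul_mem_iff _ hGa).1 h
    have h := Submodule.sup_pow_succ_le W' (Submodule.span k {z}) m
    rw [← hW, Submodule.span_pow, Set.singleton_pow] at h
    refine h.trans (sup_le le_rfl ?_)
    simpa using hpow

/-- **Linear Noether normalization**: if `V` is a finite-dimensional space of forms of degree one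
over an infinite field, then some subspace `W` with an algebraically independent basis satisfies
`V ^ (c + 1) ≤ V ^ c * W` for some `c`. -/
theorem Submodule.exists_algebraicIndependent_pow_succ_le [Infinite k] [Nontrivial A]
    {δ : A →ₐ[k] Polynomial A} {V : Submodule k A} (hδ : IsDegreeOneCoaction δ V) (hV : V.FG) :
    ∃ (n c : ℕ) (y : Fin n → A), AlgebraicIndependent k y ∧ (∀ i, y i ∈ V) ∧
      V ^ (c + 1) ≤ V ^ c * Submodule.span k (Set.range y) := by
  classical
  -- Choose W of least dimension; V itself qualifies with c = 0. A dependent basis would allow a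
  -- smaller W.
  let P : ℕ → Prop := fun n => ∃ W ≤ V, Module.finrank k W = n ∧ ∃ c, V ^ (c + 1) ≤ V ^ c * W
  have hP : ∃ n, P n := ⟨_, V, le_rfl, rfl, 0, by simp⟩
  obtain ⟨W, hWV, hn, c, hc⟩ := Nat.find_spec hP
  have : Module.Finite k V := Module.Finite.of_fg hV
  have hWfin : Module.Finite k W := Submodule.finiteDimensional_of_le hWV
  let b := Module.finBasis k W
  let y : Fin (Module.finrank k W) → A := fun i => b i
  have hy : Submodule.span k (Set.range y) = W := by
    have h1 : Set.range y = W.subtype '' Set.range b := by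
      rw [← Set.range_comp]
      rfl
    rw [h1, Submodule.span_image, b.span_eq, Submodule.map_subtype_top]
  refine ⟨_, c, y, ?_, fun i => hWV (b i).2, hy.symm ▸ hc⟩
  by_contra hind
  obtain ⟨W', hW', hlt, m, hm⟩ := Submodule.exists_finrank_lt_of_not_algebraicIndependent
    (fun v hv => hδ v (hWV hv)) hy hind
  refine Nat.find_min hP (hn ▸ hlt) ⟨W', hW'.trans hWV, rfl, c + m, ?_⟩
  calc V ^ (c + m + 1) ≤ V ^ c * W ^ (m + 1) := Submodule.pow_add_le_of_pow_succ_le hc (m + 1)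
    _ ≤ V ^ c * (W' * W ^ m) := mul_le_mul' le_rfl hm
    _ = V ^ c * W ^ m * W' := by rw [mul_comm W', mul_assoc]
    _ ≤ V ^ c * V ^ m * W' :=
      mul_le_mul' (mul_le_mul' le_rfl (pow_le_pow_left' hWV m)) le_rfl
    _ = V ^ (c + m) * W' := by rw [pow_add]

/-- The hypothesis makes A a finite module over the polynomial ring k[y], generated by (1 + V)^c,
and k[y] embeds in A. -/
theorem natCast_le_ringKrullDim_of_pow_succ_le {V : Submodule k A} (hV : V.FG)
    (hgen : Algebra.adjoin k (V : Set A) = ⊤) {n c : ℕ} {y : Fin n → A}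
    (hy : AlgebraicIndependent k y)
    (hc : V ^ (c + 1) ≤ V ^ c * Submodule.span k (Set.range y)) :
    (n : WithBot ℕ∞) ≤ ringKrullDim A := by
  let _ : Algebra (MvPolynomial (Fin n) k) A := (aeval y).toRingHom.toAlgebra
  have hmap : ∀ F : MvPolynomial (Fin n) k, algebraMap _ A F = aeval y F := fun _ => rfl
  have : IsScalarTower k (MvPolynomial (Fin n) k) A :=
    IsScalarTower.of_algebraMap_eq fun r => by rw [hmap, AlgHom.commutes]
  set U : Submodule k A := 1 ⊔ V
  set W : Submodule k A := Submodule.span k (Set.range y)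
  let M := Submodule.span (MvPolynomial (Fin n) k) ((U ^ c : Submodule k A) : Set A)
  have hU : (1 : Submodule k A) ≤ U := le_sup_left
  have hUM : U ^ c ≤ M.restrictScalars k := Submodule.subset_span
  have hWM : U ^ c * W ≤ M.restrictScalars k := by
    rw [Submodule.mul_le]
    intro x hx w hw
    have : W ≤ (M.restrictScalars k).comap (LinearMap.mulLeft k x) := by
      rw [Submodule.span_le]
      rintro _ ⟨i, rfl⟩
      have := M.smul_mem (X i) (hUM hx)
      rwa [Algebra.smul_def, hmap, aeval_X, mul_comm] at this
    exact this hw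
  have hVM : ∀ v ∈ V, ∀ x ∈ M, v * x ∈ M := by
    intro v hv x hx
    induction hx using Submodule.span_induction with
    | zero => simp
    | add x y _ _ hx hy => rw [mul_add]; exact add_mem hx hy
    | smul a x _ hx => rw [mul_smul_comm]; exact M.smul_mem a hx
    | mem x hx =>
      have h1 : v * x ∈ U ^ (c + 1) := by
        rw [pow_succ']
        exact Submodule.mul_mem_mul (Submodule.mem_sup_right hv) hx
      have h2 : U ^ (c + 1) ≤ M.restrictScalars k := by
        refine (Submodule.sup_pow_succ_le 1 V c).trans (sup_le (by simpa using hUM) ?_)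
        exact hc.trans ((mul_le_mul' (pow_le_pow_left' le_sup_right c) le_rfl).trans hWM)
      exact h2 h1
  have hMtop : M = ⊤ := by
    rw [eq_top_iff]
    rintro t -
    have ht : t ∈ Algebra.adjoin k (V : Set A) := hgen ▸ Algebra.mem_top
    have key : ∀ x ∈ M, t * x ∈ M := by
      induction ht using Algebra.adjoin_induction with
      | mem v hv => exact hVM v hv
      | algebraMap r =>
        intro x hx
        rw [← Algebra.smul_def]
        exact (M.restrictScalars k).smul_mem r hx
      | add a b _ _ ha hb =>
        intro x hx
        rw [add_mul]
        exact add_mem (ha x hx) (hb x hx)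
      | mul a b _ _ ha hb =>
        intro x hx
        rw [mul_assoc]
        exact ha _ (hb x hx)
    have h1 : (1 : A) ∈ M :=
      hUM ((one_le_pow_of_one_le' hU c) (Submodule.one_le.1 le_rfl))
    simpa using key 1 h1
  have hfin : Module.Finite (MvPolynomial (Fin n) k) A := by
    refine ⟨hMtop ▸ Submodule.FG.span_tower (Submodule.FG.pow (Submodule.FG.sup ?_ hV) c)⟩
    exact ⟨{1}, by simp [Submodule.one_eq_span]⟩
  have := Algebra.IsIntegral.of_finite (MvPolynomial (Fin n) k) A
  have h := ringKrullDim_le_of_isIntegral_of_injective (MvPolynomial (Fin n) k) A hy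
  rwa [MvPolynomial.ringKrullDim_of_isNoetherianRing, ringKrullDim_eq_zero_of_field, zero_add,
    Nat.card_fin] at h

end LinearNoetherNormalization

/-! ### Base change and containment in Frobenius powers -/

section FrobeniusPowers

open TensorProduct

theorem Ideal.span_submodule_pow_le {k A : Type*} [CommSemiring k] [CommRing A] [Algebra k A]
    (V : Submodule k A) (m : ℕ) :
    Ideal.span (V : Set A) ^ m ≤ Ideal.span ((V ^ m : Submodule k A) : Set A) := by
  rw [Ideal.span, Submodule.span_pow]
  exact Submodule.span_mono (Submodule.pow_subset_pow V)

theorem Submodule.span_range_pow_le_ideal {k A ι : Type*} [CommSemiring k] [CommRing A]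
    [Algebra k A] (y : ι → A) (m : ℕ) :
    Submodule.span k (Set.range y) ^ m ≤ (Ideal.span (Set.range y) ^ m).restrictScalars k := by
  rw [Ideal.span, Submodule.span_pow, Submodule.span_pow, Submodule.span_le]
  exact Submodule.subset_span

variable {K S : Type*} [Field K] [CommRing S] [Algebra K S] (L : Type*) [Field L] [Algebra K L]

/-- The `L`-span of `1 ⊗ V` in `L ⊗ S`. -/
noncomputable def Submodule.tensorSpan (V : Submodule K S) : Submodule L (L ⊗[K] S) :=
  Submodule.span L (Algebra.TensorProduct.includeRight (R := K) (A := L) '' (V : Set S))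

theorem Submodule.FG.tensorSpan {V : Submodule K S} (hV : V.FG) :
    (Submodule.tensorSpan L V).FG := by
  have := (hV.map (Algebra.TensorProduct.includeRight (R := K) (A := L)
    (B := S)).toLinearMap).span_tower (A := L)
  exact this

theorem adjoin_tensorSpan_eq_top {V : Submodule K S}
    (hV : Algebra.adjoin K (V : Set S) = ⊤) :
    Algebra.adjoin L (Submodule.tensorSpan L V : Set (L ⊗[K] S)) = ⊤ := by
  rw [eq_top_iff]
  rintro t -
  have key : ∀ s : S, (1 : L) ⊗ₜ[K] s ∈
      Algebra.adjoin L (Submodule.tensorSpan L V : Set (L ⊗[K] S)) := by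
    intro s
    have hs : s ∈ Algebra.adjoin K (V : Set S) := hV ▸ Algebra.mem_top
    induction hs using Algebra.adjoin_induction with
    | mem v hv => exact Algebra.subset_adjoin (Submodule.subset_span ⟨v, hv, rfl⟩)
    | algebraMap r =>
      have : (1 : L) ⊗ₜ[K] algebraMap K S r = algebraMap L (L ⊗[K] S) (algebraMap K L r) := by
        rw [Algebra.algebraMap_eq_smul_one, tmul_smul, smul_tmul', ← Algebra.algebraMap_eq_smul_one,
          Algebra.TensorProduct.algebraMap_apply, Algebra.algebraMap_self_apply]
      rw [this]
      exact Subalgebra.algebraMap_mem _ _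
    | add a b _ _ ha hb =>
      rw [tmul_add]
      exact add_mem ha hb
    | mul a b _ _ ha hb =>
      have := mul_mem ha hb
      rwa [Algebra.TensorProduct.tmul_mul_tmul, one_mul] at this
  induction t using TensorProduct.induction_on with
  | zero => exact zero_mem _
  | add a b ha hb => exact add_mem ha hb
  | tmul l s =>
    have := Subalgebra.smul_mem _ (key s) l
    rwa [smul_tmul', smul_eq_mul, mul_one] at this

/-- The coaction on `L ⊗ S` induced by a coaction on `S`. -/
noncomputable def tensorCoaction (δ : S →ₐ[K] Polynomial S) : L ⊗[K] S →ₐ[L] Polynomial (L ⊗[K] S) :=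
  Algebra.TensorProduct.lift (Algebra.ofId L _)
    ((Polynomial.mapAlgHom (Algebra.TensorProduct.includeRight (R := K) (A := L))).comp δ)
    (fun _ _ => Commute.all _ _)

theorem IsDegreeOneCoaction.tensor {δ : S →ₐ[K] Polynomial S} {V : Submodule K S}
    (hδ : IsDegreeOneCoaction δ V) :
    IsDegreeOneCoaction (tensorCoaction L δ) (Submodule.tensorSpan L V) := by
  intro t ht
  induction ht using Submodule.span_induction with
  | zero => simp
  | add a b _ _ ha hb => rw [map_add, map_add, ha, hb]
  | smul l a _ ha => rw [map_smul, ha, Polynomial.smul_monomial]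
  | mem t ht =>
    obtain ⟨v, hv, rfl⟩ := ht
    simp [tensorCoaction, hδ v hv]

/-- A K-linear retraction of K → L, tensored with S, is S-linear; hence extended ideals contract
back to themselves. -/
theorem exists_retraction_tensor :
    ∃ ρ : L ⊗[K] S →+ S, (∀ s, ρ (1 ⊗ₜ s) = s) ∧ ∀ t s, ρ (t * (1 ⊗ₜ s)) = ρ t * s := by
  obtain ⟨r, hr⟩ := LinearMap.exists_leftInverse_of_injective (Algebra.linearMap K L)
    (LinearMap.ker_eq_bot.2 (algebraMap K L).injective)
  have hr1 : r 1 = 1 := by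
    have := LinearMap.congr_fun hr 1
    simpa using this
  refine ⟨((TensorProduct.lid K S).toLinearMap ∘ₗ LinearMap.rTensor S r).toAddMonoidHom, ?_, ?_⟩
  · intro s
    simp [hr1]
  · intro t s
    induction t using TensorProduct.induction_on with
    | zero => simp
    | add a b ha hb => rw [add_mul, map_add, ha, hb, map_add, add_mul]
    | tmul l a => simp

theorem mem_of_tmul_mem_map {I : Ideal S} {s : S}
    (h : (1 : L) ⊗ₜ[K] s ∈
      I.map (Algebra.TensorProduct.includeRight (R := K) (A := L) (B := S))) : s ∈ I := by
  obtain ⟨ρ, h1, hρ⟩ := exists_retraction_tensor (K := K) (S := S) L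
  rw [← h1 s]
  generalize (1 : L) ⊗ₜ[K] s = t at h
  suffices ∀ a, ρ (a * t) ∈ I by simpa using this 1
  induction h using Submodule.span_induction with
  | zero => simp
  | add a b _ _ ha hb => intro c; rw [mul_add, map_add]; exact add_mem (ha c) (hb c)
  | smul l a _ ha => intro c; rw [smul_eq_mul, ← mul_assoc]; exact ha _
  | mem t ht =>
    obtain ⟨v, hv, rfl⟩ := ht
    intro a
    have := hρ a v
    simp only [Algebra.TensorProduct.includeRight_apply]
    rw [this]
    exact I.mul_mem_left _ hv

theorem ringKrullDim_tensor_le [Algebra.IsIntegral K L] :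
    ringKrullDim (L ⊗[K] S) ≤ ringKrullDim S := by
  rw [ringKrullDim_eq_of_ringEquiv (Algebra.TensorProduct.comm K L S).toRingEquiv]
  exact ringKrullDim_le_of_isIntegral S (S ⊗[K] L)

variable {L} in
/-- If `V` generates a graded algebra `S` in degree one, then high powers of the ideal `(V)` lie in
its Frobenius powers: `(V) ^ (n q + O(1)) ≤ (v ^ q : v ∈ V)` for some `n ≤ dim S`. -/
theorem exists_span_pow_le_frobenius_power (p : ℕ) [Fact p.Prime] [CharP K p] [Nontrivial S]
    {δ : S →ₐ[K] Polynomial S} {V : Submodule K S} (hδ : IsDegreeOneCoaction δ V) (hV : V.FG)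
    (hgen : Algebra.adjoin K (V : Set S) = ⊤) :
    ∃ n c : ℕ, (n : WithBot ℕ∞) ≤ ringKrullDim S ∧ ∀ e : ℕ,
      Ideal.span (V : Set S) ^ (c + (n * p ^ e + 1)) ≤
        Ideal.span ((fun v => v ^ p ^ e) '' (V : Set S)) := by
  -- The algebraic closure is infinite, as normalization requires, and integral over K, so the
  -- dimension does not grow.
  let F := AlgebraicClosure K
  have : Nontrivial (F ⊗[K] S) := by
    obtain ⟨ρ, h1, -⟩ := exists_retraction_tensor (K := K) (S := S) F
    exact Function.Surjective.nontrivial (f := ρ) fun s => ⟨_, h1 s⟩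
  have : CharP (F ⊗[K] S) p :=
    charP_of_injective_algebraMap (algebraMap K (F ⊗[K] S)).injective p
  obtain ⟨n, c, y, hy, hyV, hc⟩ :=
    Submodule.exists_algebraicIndependent_pow_succ_le (hδ.tensor F) (hV.tensorSpan F)
  refine ⟨n, c, (natCast_le_ringKrullDim_of_pow_succ_le (hV.tensorSpan F)
    (adjoin_tensorSpan_eq_top F hgen) hy hc).trans (ringKrullDim_tensor_le (K := K) F), fun e f hf => ?_⟩
  set VT := Submodule.tensorSpan F V
  let ι : S →+* F ⊗[K] S :=
    (Algebra.TensorProduct.includeRight (R := K) (A := F) (B := S)).toRingHom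
  apply mem_of_tmul_mem_map (K := K) F
  set Q := Ideal.span ((fun v => v ^ p ^ e) '' (V : Set S))
  -- The q-th power map is additive, so generators 1 ⊗ v suffice for all of their F-span.
  have hpow : ∀ t ∈ VT, t ^ p ^ e ∈ Q.map ι := by
    intro t ht
    induction ht using Submodule.span_induction with
    | zero => simp [zero_pow (pow_ne_zero e (Fact.out (p := p.Prime)).ne_zero)]
    | add a b _ _ ha hb => rw [add_pow_char_pow]; exact add_mem ha hb
    | smul l a _ ha =>
      rw [smul_pow, Algebra.smul_def]
      exact Ideal.mul_mem_left _ _ ha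
    | mem t ht =>
      obtain ⟨v, hv, rfl⟩ := ht
      have : ι (v ^ p ^ e) ∈ Q.map ι :=
        Ideal.mem_map_of_mem _ (Ideal.subset_span ⟨v, hv, rfl⟩)
      rwa [map_pow] at this
  have h1 : ι f ∈ Ideal.span (VT : Set (F ⊗[K] S)) ^ (c + (n * p ^ e + 1)) := by
    have h := Ideal.mem_map_of_mem ι hf
    rw [Ideal.map_pow, Ideal.map_span] at h
    exact Ideal.pow_right_mono (Ideal.span_mono Submodule.subset_span) _ h
  have h2 : VT ^ (c + (n * p ^ e + 1)) ≤ (Q.map ι).restrictScalars F := by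
    refine (Submodule.pow_add_le_of_pow_succ_le hc _).trans ?_
    rw [Submodule.mul_le]
    intro a _ b hb
    refine Ideal.mul_mem_left _ a ?_
    have h3 := Ideal.span_range_pow_le y (p ^ e) (Submodule.span_range_pow_le_ideal y _ hb)
    refine (Ideal.span_le.2 ?_ : Ideal.span (Set.range fun i => y i ^ p ^ e) ≤ Q.map ι) h3
    rintro _ ⟨i, rfl⟩
    exact hpow _ (hyV i)
  exact (Ideal.span_le.2 h2 : _ ≤ Q.map ι) (Ideal.span_submodule_pow_le VT _ h1)

end FrobeniusPowers

namespace FThreshold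

/-! ### Bounding the threshold by Frobenius powers -/

section SplittingDimension

variable (p : ℕ) [Fact p.Prime] {S : Type u} [CommRing S] [Algebra (ZMod p) S]

/-- Since φ((a v^q)^{1/q}) = v φ(a^{1/q}), φ maps the Frobenius power into I, which does not contain
1. -/
theorem notMem_of_split {I : Ideal S} (hI : I ≠ ⊤) {e : ℕ} {f : S} {φ : Root p e S →ₗ[S] S}
    (hφ : φ (root p e f) = 1) {s : Set S} (hs : s ⊆ I) :
    f ∉ Ideal.span ((fun v => v ^ p ^ e) '' s) := by
  intro hf
  apply hI
  rw [Ideal.eq_top_iff_one, ← hφ]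
  suffices ∀ a, φ (root p e (a * f)) ∈ I by simpa using this 1
  clear hφ
  induction hf using Submodule.span_induction with
  | zero => simp
  | add a b _ _ ha hb =>
    intro c
    rw [mul_add, map_add, map_add]
    exact add_mem (ha c) (hb c)
  | smul l a _ ha => intro c; rw [smul_eq_mul, ← mul_assoc]; exact ha _
  | mem t ht =>
    obtain ⟨v, hv, rfl⟩ := ht
    intro a
    rw [mul_comm, root_mul_smul, smul_eq_mul]
    exact I.mul_mem_right _ (hs hv)

theorem fpt_le_natCast {I : Ideal S} (hI : I ≠ ⊤) {s : Set S} (hs : s ⊆ I) {n c : ℕ}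
    (h : ∀ e, I ^ (c + (n * p ^ e + 1)) ≤ Ideal.span ((fun v => v ^ p ^ e) '' s)) :
    fpt p I ≤ n := by
  refine iSup₂_le fun t ht => ?_
  have hp : (1 : ℝ) < p := by exact_mod_cast (Fact.out (p := p.Prime)).one_lt
  have hlt : ∀ᶠ e : ℕ in atTop, ((p : ℝ) ^ e - 1) * t < n * (p : ℝ) ^ e + (c + 1) := by
    filter_upwards [ht] with e he
    obtain ⟨f, hf, φ, hφ⟩ := he
    rw [toSpanSingleton_comp_eq_id_iff] at hφ
    have h1 : ⌊((p : ℝ) ^ e - 1) * (t : ℝ)⌋₊ < c + (n * p ^ e + 1) := by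
      by_contra! hle
      exact notMem_of_split p hI hφ hs (h e (Ideal.pow_le_pow_right hle hf))
    have h2 := Nat.lt_of_floor_lt h1
    push_cast at h2
    linarith
  -- If t > n, then (t - n) p^e eventually exceeds the constant t + c + 1.
  have hle : (t : ℝ) ≤ n := by
    by_contra! hnt
    have hlim := (tendsto_pow_atTop_atTop_of_one_lt hp).const_mul_atTop (sub_pos.2 hnt)
    obtain ⟨e, h1, h2⟩ := (hlt.and (hlim.eventually_ge_atTop (t + (c + 1)))).exists
    nlinarith
  exact_mod_cast hle

end SplittingDimension

/-! ### Standard graded algebras and their homogeneous quotients -/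

section GradedCoaction

variable {K : Type*} {R : Type u} [Field K] [CommRing R] [Algebra K R]
  (𝒜 : ℕ → Submodule K R) [GradedAlgebra 𝒜]

open DirectSum

/-- The coaction `R → R[X]` of a graded algebra, which sends `x ∈ R_i` to `x X ^ i`. -/
noncomputable def gradedCoaction : R →ₐ[K] Polynomial R :=
  (DirectSum.toAlgebra K (fun i => 𝒜 i)
    (fun i => ((Polynomial.monomial i).restrictScalars K).comp (𝒜 i).subtype)
    (by rfl)
    (fun a b => (Polynomial.monomial_mul_monomial _ _ _ _).symm)).comp
    (decomposeAlgEquiv 𝒜).toAlgHom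

theorem gradedCoaction_of_mem {i : ℕ} {x : R} (hx : x ∈ 𝒜 i) :
    gradedCoaction 𝒜 x = Polynomial.monomial i x := by
  have : decomposeAlgEquiv 𝒜 x = DirectSum.of (fun i => 𝒜 i) i ⟨x, hx⟩ :=
    decompose_of_mem 𝒜 hx
  simp only [gradedCoaction, AlgHom.comp_apply]
  erw [this]
  exact DirectSum.toAddMonoid_of (β := fun i => 𝒜 i) (fun i => (((Polynomial.monomial i).restrictScalars
    K).comp (𝒜 i).subtype).toAddMonoidHom) i ⟨x, hx⟩

/-- Homogeneity puts every component of x ∈ P back in P, so the coaction descends to R/P. -/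
theorem exists_isDegreeOneCoaction_quotient {P : Ideal R} (hP : P.IsHomogeneous 𝒜) :
    ∃ δ : (R ⧸ P) →ₐ[K] Polynomial (R ⧸ P),
      IsDegreeOneCoaction δ ((𝒜 1).map (Ideal.Quotient.mkₐ K P).toLinearMap) := by
  classical
  let g : R →ₐ[K] Polynomial (R ⧸ P) :=
    (Polynomial.mapAlgHom (Ideal.Quotient.mkₐ K P)).comp (gradedCoaction 𝒜)
  have hg : ∀ {i : ℕ} {x : R}, x ∈ 𝒜 i → g x = Polynomial.monomial i (Ideal.Quotient.mk P x) := by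
    intro i x hx
    simp [g, gradedCoaction_of_mem 𝒜 hx]
  refine ⟨Ideal.Quotient.liftₐ P g fun x hx => ?_, ?_⟩
  · rw [← DirectSum.sum_support_decompose 𝒜 x, map_sum]
    refine Finset.sum_eq_zero fun i _ => ?_
    rw [hg (SetLike.coe_mem _), Ideal.Quotient.eq_zero_iff_mem.2 (hP i hx), map_zero]
  · rintro _ ⟨x, hx, rfl⟩
    exact hg hx

variable {𝒜}

/-- Every element is a constant plus an element of (R_1); for an element of 𝔪 the constant is its
degree-0 part, hence zero. -/
theorem IsStandardGraded.irrelevant_le_span (hR : IsStandardGraded 𝒜) :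
    (HomogeneousIdeal.irrelevant 𝒜).toIdeal ≤ Ideal.span (𝒜 1 : Set R) := by
  intro x hx
  have hspan : ∀ y : R, ∃ a : K, y - algebraMap K R a ∈ Ideal.span (𝒜 1 : Set R) := by
    intro y
    have hy : y ∈ Algebra.adjoin K (𝒜 1 : Set R) := hR.generated ▸ Algebra.mem_top
    induction hy using Algebra.adjoin_induction with
    | mem v hv => exact ⟨0, by simpa using Ideal.subset_span hv⟩
    | algebraMap r => exact ⟨r, by simp⟩
    | add y z _ _ hy hz =>
      obtain ⟨a, ha⟩ := hy
      obtain ⟨b, hb⟩ := hz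
      exact ⟨a + b, by rw [map_add, add_sub_add_comm]; exact add_mem ha hb⟩
    | mul y z _ _ hy hz =>
      obtain ⟨a, ha⟩ := hy
      obtain ⟨b, hb⟩ := hz
      refine ⟨a * b, ?_⟩
      have : y * z - algebraMap K R (a * b) =
          z * (y - algebraMap K R a) + algebraMap K R a * (z - algebraMap K R b) := by
        rw [map_mul]
        ring
      rw [this]
      exact add_mem (Ideal.mul_mem_left _ _ ha) (Ideal.mul_mem_left _ _ hb)
  have hle : Ideal.span (𝒜 1 : Set R) ≤ (HomogeneousIdeal.irrelevant 𝒜).toIdeal :=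
    Ideal.span_le.2 fun v hv => HomogeneousIdeal.mem_irrelevant_of_mem 𝒜 one_pos hv
  obtain ⟨a, ha⟩ := hspan x
  have h0 : algebraMap K R a ∈ (HomogeneousIdeal.irrelevant 𝒜).toIdeal := by
    simpa using sub_mem hx (hle ha)
  have h1 : algebraMap K R a = 0 := by
    have h2 : (decompose 𝒜 (algebraMap K R a) 0 : R) = 0 := h0
    rwa [decompose_of_mem_same 𝒜 (SetLike.algebraMap_mem_graded 𝒜 a)] at h2
  simpa [h1] using ha

theorem IsStandardGraded.irrelevant_ne_top (hR : IsStandardGraded 𝒜) :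
    (HomogeneousIdeal.irrelevant 𝒜).toIdeal ≠ ⊤ := by
  intro h
  have h1 : (1 : R) ∈ (HomogeneousIdeal.irrelevant 𝒜).toIdeal := h ▸ Submodule.mem_top
  have h2 : (decompose 𝒜 (1 : R) 0 : R) = 0 := h1
  rw [decompose_of_mem_same 𝒜 (SetLike.one_mem_graded 𝒜)] at h2
  have := hR.injective (a₁ := 1) (a₂ := 0) (by simpa using h2)
  exact one_ne_zero this

/-- For a homogeneous proper ideal `P` of a standard graded algebra `R`,
`fpt (R / P) ≤ dim (R / P)`. -/
theorem IsStandardGraded.exists_fpt_quotient_le (p : ℕ) [Fact p.Prime] [CharP K p]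
    [Algebra (ZMod p) R] (hR : IsStandardGraded 𝒜) {P : Ideal R} (hP : P.IsHomogeneous 𝒜)
    (hPm : P ≤ (HomogeneousIdeal.irrelevant 𝒜).toIdeal) :
    ∃ n : ℕ, (n : WithBot ℕ∞) ≤ ringKrullDim (R ⧸ P) ∧
      fpt p ((HomogeneousIdeal.irrelevant 𝒜).toIdeal.map (Ideal.Quotient.mk P)) ≤ n := by
  let 𝔪 := (HomogeneousIdeal.irrelevant 𝒜).toIdeal
  have : Nontrivial (R ⧸ P) := Ideal.Quotient.nontrivial_iff.2
    fun h => hR.irrelevant_ne_top (top_le_iff.1 (h ▸ hPm))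
  obtain ⟨δ, hδ⟩ := exists_isDegreeOneCoaction_quotient 𝒜 hP
  let V := (𝒜 1).map (Ideal.Quotient.mkₐ K P).toLinearMap
  have hVcoe : (V : Set (R ⧸ P)) = Ideal.Quotient.mk P '' (𝒜 1 : Set R) := rfl
  have hV : V.FG := Submodule.FG.map _ ((Module.Finite.iff_fg).1 hR.finite)
  have hgen : Algebra.adjoin K (V : Set (R ⧸ P)) = ⊤ := by
    have h := AlgHom.map_adjoin (Ideal.Quotient.mkₐ K P) (𝒜 1 : Set R)
    rw [hR.generated, Algebra.map_top, (AlgHom.range_eq_top _).2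
      (Ideal.Quotient.mkₐ_surjective K P)] at h
    exact h.symm
  obtain ⟨n, c, hn, hc⟩ := exists_span_pow_le_frobenius_power p hδ hV hgen
  have hle : 𝔪.map (Ideal.Quotient.mk P) ≤ Ideal.span (V : Set (R ⧸ P)) := by
    rw [hVcoe, ← Ideal.map_span]
    exact Ideal.map_mono hR.irrelevant_le_span
  have hpow : ∀ e, 𝔪.map (Ideal.Quotient.mk P) ^ (c + (n * p ^ e + 1)) ≤
      Ideal.span ((fun v => v ^ p ^ e) '' (V : Set (R ⧸ P))) :=
    fun e => (Ideal.pow_right_mono hle _).trans (hc e)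
  have hsub : (V : Set (R ⧸ P)) ⊆ 𝔪.map (Ideal.Quotient.mk P) := by
    rw [hVcoe]
    rintro _ ⟨x, hx, rfl⟩
    exact Ideal.mem_map_of_mem _ (HomogeneousIdeal.mem_irrelevant_of_mem 𝒜 one_pos hx)
  -- As P ≤ 𝔪, the preimage of 𝔪(R/P) is 𝔪, which is proper.
  have hne : 𝔪.map (Ideal.Quotient.mk P) ≠ ⊤ := by
    intro h
    have h1 := Ideal.comap_map_of_surjective (Ideal.Quotient.mk P) Ideal.Quotient.mk_surjective 𝔪
    rw [h, Ideal.comap_top, ← RingHom.ker_eq_comap_bot, Ideal.mk_ker, sup_eq_left.2 hPm] at h1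
    exact hR.irrelevant_ne_top h1.symm
  exact ⟨n, hn, fpt_le_natCast p hne hsub hpow⟩

end GradedCoaction

end FThreshold

theorem theorem4p5 (p : ℕ) [Fact p.Prime]
    (K : Type*) [Field K] [CharP K p]
    (R : Type u) [CommRing R] [Algebra (ZMod p) R] [Algebra K R]
    (𝒜 : ℕ → Submodule K R) [GradedAlgebra 𝒜] (hR : IsStandardGraded 𝒜)
    (hfin : IsFFinite p R) (hpure : IsFPure p R)
    (𝔪 : Ideal R) (h𝔪 : 𝔪 = (HomogeneousIdeal.irrelevant 𝒜).toIdeal) :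
    (∀ J : Ideal R, IsCompatible p J →
      fpt p 𝔪 ≤ fpt p (𝔪.map (Ideal.Quotient.mk J))) ∧
    fpt p 𝔪 ≤ fpt p (𝔪.map (Ideal.Quotient.mk (testIdeal p R))) ∧
    fpt p 𝔪 ≤ fpt p (𝔪.map (Ideal.Quotient.mk (splittingPrime p 𝔪))) ∧
    ((fpt p (𝔪.map (Ideal.Quotient.mk (splittingPrime p 𝔪))) : ℝ≥0∞) : WithBot ℝ≥0∞) ≤
      (sdim p 𝔪).map ENat.toENNReal := by
  subst h𝔪
  refine ⟨fun J hJ => fpt_le_fpt_map_quotient p _ hJ,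
    fpt_le_fpt_map_quotient p _ (isCompatible_testIdeal p R),
    fpt_le_fpt_map_quotient p _ (isCompatible_splittingPrime p _), ?_⟩
  -- The number n of independent linear forms separates the threshold from the dimension, so the two
  -- are never compared directly.
  obtain ⟨n, hn, hfpt⟩ := hR.exists_fpt_quotient_le p (isHomogeneous_splittingPrime p 𝒜)
    (splittingPrime_le p _)
  refine (WithBot.coe_le_coe.2 hfpt).trans ?_
  have h := (WithBot.monotone_map_iff.2 ENat.toENNReal_mono) hn
  exact h
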